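/- For integers $r\ge 3$ and $g$, let $G(g,r)$ be the family of all (nonempty, finite, simple) $r$-regular graphs with girth at least $g$, where the girth is the length of a shortest cycle. For a finite graph $G$ with node set $V$, let $\mathcal{IG}=\mathcal{IG}(G)$ be the random independent set returned by the randomized greedy algorithm: starting from the set of all nodes, repeatedly select a node uniformly at random from all remaining nodes, add it to the independent set, and delete it and all remaining nodes adjacent to it, until no node remains. Then for every $r\ge 3$, $$\lim_{g\to\infty}\ \inf_{G\in G(g,r)}\mathbb{E}\!\left[\frac{|\mathcal{IG}|}{|V|}\right]=\lim_{g\to\infty}\ \sup_{G\in G(g,r)}\mathbb{E}\!\left[\frac{|\mathcal{IG}|}{|V|}\right]=\frac{1-(r-1)^{-\frac{2}{r-2}}}{2}.$$ -/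

import Mathlib

open Filter Topology

open Classical in
/-- The random independent set produced by the greedy algorithm when `R` is the set of remaining
nodes: if no node remains, stop with the empty set; otherwise select a node `v` uniformly at random
from `R`, delete `v` and all remaining nodes adjacent to `v`, run the algorithm on what is left,
and add `v` to the result. -/
noncomputable def greedyFrom {V : Type*} (G : SimpleGraph V) (R : Finset V) : PMF (Finset V) :=
  if h : R.Nonempty then
    haveI : Nonempty R := h.to_subtype
    (PMF.uniformOfFintype R).bind fun v =>
      (greedyFrom G (R.filter fun w => w ≠ v.1 ∧ ¬ G.Adj v.1 w)).map fun I => insert v.1 I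
  else PMF.pure ∅
termination_by R.card
decreasing_by
  exact Finset.card_lt_card (Finset.filter_ssubset.2 ⟨v.1, v.2, by simp⟩)

/-- The law of the independent set returned by the greedy algorithm on the finite graph `G`. -/
noncomputable def greedyIndepSet {V : Type*} [Fintype V] (G : SimpleGraph V) : PMF (Finset V) :=
  greedyFrom G Finset.univ

/-- The expectation of `|I| / |V|`, where `I` is the random greedy independent set of `G`. -/
noncomputable def expectedGreedyRatio {V : Type*} [Fintype V] (G : SimpleGraph V) : ℝ :=
  ∑ I : Finset V, (greedyIndepSet G I).toReal * ((I.card : ℝ) / (Fintype.card V : ℝ))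

open Classical in
/-- The family of all nonempty finite `r`-regular graphs in which every cycle has length at
least `g`. -/
structure RegularGirthGraph (g r : ℕ) where
  V : Type
  [fintypeV : Fintype V]
  [nonemptyV : Nonempty V]
  graph : SimpleGraph V
  regular : graph.IsRegularOfDegree r
  girth_ge : (g : ℕ∞) ≤ graph.egirth

/-- The expectation of `|I| / |V|` for a member of the family. -/
noncomputable def RegularGirthGraph.ratio {g r : ℕ} (H : RegularGirthGraph g r) : ℝ :=
  letI := H.fintypeV
  expectedGreedyRatio H.graph

/-! Put `r = d + 2` and run the greedy algorithm in continuous time, selecting each remaining node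
at rate one. For a set `S`, rescale the probability that `S` still remains at time `t` by `exp (|S|
t)`. These quantities satisfy a linear hierarchy: the derivative at `S` is `-exp (-t)` times the sum
of the values at `insert w S`, over `w` in the outer boundary (`hasDerivAt_survival`). When the
girth is large, a connected `S` induces a tree and has exactly `d |S| + 2` boundary nodes
(`IsClusterOf.card_outerBoundary`), so the hierarchy depends only on `|S|`. On the infinite tree it
is solved by `q ^ (d |S| + 2)`, where `q' = -exp (-t) q ^ (d + 1)` and `q 0 = 1`.

Finite girth truncates the hierarchy at some size `K`, where only the trivial error bound 1 is
available. `abs_survival_sub_le` shows that this has little effect over a short time window, and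
`exists_girth_abs_survival_sub_le` chains windows to reach any fixed time. Selections per node occur
at rate close to `exp (-t) q ^ (d + 2)`, whose integral is `(1 - q ^ 2) / 2`; letting time tend to
infinity gives the constant, uniformly over the family (`exists_girth_abs_ratio_sub_le`). -/

/-! ### Regular graphs of large girth -/

/-- Reduced words of length at most `N` in the free product of `r` groups of order two. -/
def ReducedWord (r N : ℕ) : Type :=
  {w : List (Fin r) // w.IsChain (· ≠ ·) ∧ w.length ≤ N}

instance ReducedWord.finite (r N : ℕ) : Finite (ReducedWord r N) :=
  ((List.finite_length_le (Fin r) N).subset fun _ h => h.2).to_subtype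

/-- Multiplication of a word by the letter `i`, staying put if the product is too long. -/
def letterStep {r : ℕ} (N : ℕ) (i : Fin r) (w : List (Fin r)) : List (Fin r) :=
  if w.head? = some i then w.tail else if w.length < N then i :: w else w

theorem letterStep_mem {r N : ℕ} (i : Fin r) {w : List (Fin r)}
    (hw : w.IsChain (· ≠ ·) ∧ w.length ≤ N) :
    (letterStep N i w).IsChain (· ≠ ·) ∧ (letterStep N i w).length ≤ N := by
  unfold letterStep
  split_ifs with h1 h2
  · exact ⟨hw.1.tail, by simp; omega⟩
  · refine ⟨List.isChain_cons.2 ⟨fun y hy hiy => h1 ?_, hw.1⟩, by simpa using h2⟩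
    rw [hiy]; exact hy
  · exact hw

/-- Deleting and prepending `i` undo each other; words of full length `N` not starting with `i` are
fixed. -/
theorem letterStep_letterStep {r N : ℕ} (i : Fin r) {w : List (Fin r)}
    (hw : w.IsChain (· ≠ ·) ∧ w.length ≤ N) :
    letterStep N i (letterStep N i w) = w := by
  rcases w with _ | ⟨j, t⟩
  · by_cases hN : 0 < N <;> simp [letterStep, hN]
  · by_cases hj : j = i
    · subst hj
      have h1 : t.head? ≠ some j := fun h => (List.isChain_cons.1 hw.1).1 j h rfl
      have h2 : t.length < N := by simpa using hw.2
      simp [letterStep, h1, h2]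
    · by_cases h2 : t.length + 1 < N <;> simp [letterStep, hj, h2]

/-- The involution of reduced words given by a letter. -/
def letterPerm {r : ℕ} (N : ℕ) (i : Fin r) : Equiv.Perm (ReducedWord r N) :=
  Function.Involutive.toPerm (fun w => ⟨letterStep N i w.1, letterStep_mem i w.2⟩)
    fun w => Subtype.ext (letterStep_letterStep i w.2)

theorem letterPerm_mul_self {r N : ℕ} (i : Fin r) :
    letterPerm N i * letterPerm N i = 1 :=
  Equiv.ext fun w => Subtype.ext (letterStep_letterStep i w.2)

/-- The empty word. -/
def ReducedWord.nil (r N : ℕ) : ReducedWord r N := ⟨[], by simp⟩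

theorem letterPerm_nil {r N : ℕ} (hN : 0 < N) (i : Fin r) :
    (letterPerm N i (ReducedWord.nil r N)).1 = [i] := by
  change letterStep N i [] = [i]
  simp [letterStep, hN]

theorem letterPerm_injective {r N : ℕ} (hN : 0 < N) :
    Function.Injective (letterPerm (r := r) N) := fun i j h => by
  have := letterPerm_nil hN i
  rw [h, letterPerm_nil hN j] at this
  simpa using this.symm

/-- The product of the involutions of the letters of a word, the first letter acting first. -/
def wordPerm {r : ℕ} (N : ℕ) : List (Fin r) → Equiv.Perm (ReducedWord r N)
  | [] => 1
  | i :: l => wordPerm N l * letterPerm N i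

/-- Each letter in turn is prepended: no cancellation occurs because neighbouring letters differ,
and the length bound keeps truncation away. -/
theorem wordPerm_length {r N : ℕ} (l : List (Fin r)) (w : ReducedWord r N)
    (hl : l.IsChain (· ≠ ·)) (hlw : ∀ i ∈ l.head?, w.1.head? ≠ some i)
    (hN : l.length + w.1.length ≤ N) :
    (wordPerm N l w).1.length = l.length + w.1.length := by
  induction l generalizing w with
  | nil => simp [wordPerm]
  | cons i l ih =>
    have h1 : w.1.head? ≠ some i := hlw i (by simp)
    have h2 : (letterPerm N i w).1 = i :: w.1 := by
      change letterStep N i w.1 = _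
      simp only [List.length_cons] at hN
      rw [letterStep, if_neg h1, if_pos (by omega)]
    rw [List.isChain_cons] at hl
    have := ih (letterPerm N i w) hl.2
      (fun j hj h => by
        rw [h2] at h
        exact hl.1 j hj (by simpa using h))
      (by rw [h2]; simp only [List.length_cons] at hN ⊢; omega)
    rw [wordPerm, Equiv.Perm.mul_apply, this, h2]
    simp only [List.length_cons]; omega

/-- The Cayley graph of the group of permutations of reduced words with respect to the
involutions of the letters. -/
def letterGraph (r : ℕ) {N : ℕ} (hN : 0 < N) : SimpleGraph (Equiv.Perm (ReducedWord r N)) where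
  Adj σ τ := ∃ i : Fin r, τ = letterPerm N i * σ
  symm := ⟨by
    rintro σ τ ⟨i, rfl⟩
    exact ⟨i, by rw [← mul_assoc, letterPerm_mul_self, one_mul]⟩⟩
  loopless := ⟨by
    rintro σ ⟨i, h⟩
    have h1 : letterPerm N i = 1 := by simpa using h.symm
    have h2 := letterPerm_nil hN i
    rw [h1] at h2
    exact List.cons_ne_nil i [] h2.symm⟩

/-- Letters act as involutions, so repeating a letter would recross the edge just used. The last
clause records the first edge, which the induction needs to exclude this. -/
theorem letterGraph_walk {r N : ℕ} (hN : 0 < N) {σ τ : Equiv.Perm (ReducedWord r N)}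
    (p : (letterGraph r hN).Walk σ τ) (hp : p.IsTrail) :
    ∃ l : List (Fin r), l.IsChain (· ≠ ·) ∧ l.length = p.length ∧ τ = wordPerm N l * σ ∧
      ∀ i ∈ l.head?, s(σ, letterPerm N i * σ) ∈ p.edges := by
  induction p with
  | nil => exact ⟨[], by simp, by simp, by simp [wordPerm], by simp⟩
  | @cons σ ρ τ h p ih =>
    obtain ⟨hp, hne⟩ := (SimpleGraph.Walk.isTrail_cons h p).1 hp
    obtain ⟨l, hl, hlen, hτ, hhead⟩ := ih hp
    obtain ⟨i, rfl⟩ := h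
    refine ⟨i :: l, List.isChain_cons.2 ⟨?_, hl⟩, congrArg (· + 1) hlen, ?_, ?_⟩
    · rintro j hj rfl
      refine hne ?_
      have := hhead i hj
      rwa [← mul_assoc, letterPerm_mul_self, one_mul, Sym2.eq_swap] at this
    · rw [hτ, wordPerm, mul_assoc]
    · rintro j hj
      obtain rfl : i = j := by simpa using hj
      exact List.mem_cons_self

/-- A cycle spells a reduced word acting as the identity, whereas a nonempty reduced word of length
below `N` moves the empty word. -/
theorem letterGraph_egirth {r N : ℕ} (hN : 0 < N) :
    (N : ℕ∞) ≤ (letterGraph r hN).egirth := by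
  rw [SimpleGraph.le_egirth]
  intro σ p hp
  obtain ⟨l, hl, hlen, hσ, -⟩ := letterGraph_walk hN p hp.isTrail
  by_contra hlt
  rw [not_le, Nat.cast_lt] at hlt
  have h1 : wordPerm N l = 1 := by simpa using hσ.symm
  have h2 := wordPerm_length l (ReducedWord.nil r N) hl (by simp [ReducedWord.nil])
    (by simp [ReducedWord.nil]; omega)
  rw [h1] at h2
  have := hp.three_le_length
  rw [Equiv.Perm.one_apply] at h2
  simp only [ReducedWord.nil, List.length_nil] at h2
  omega

/-- Over an empty family the real infimum and supremum would take the default value 0. -/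
instance RegularGirthGraph.nonempty (g r : ℕ) : Nonempty (RegularGirthGraph g r) := by
  classical
  have hN : 0 < g + 1 := g.succ_pos
  let _ := Fintype.ofFinite (Equiv.Perm (ReducedWord r (g + 1)))
  refine ⟨⟨_, letterGraph r hN, fun σ => ?_, ?_⟩⟩
  · have : (letterGraph r hN).neighborFinset σ =
        Finset.univ.image fun i : Fin r => letterPerm (g + 1) i * σ := by
      ext τ
      rw [SimpleGraph.mem_neighborFinset]
      simp only [letterGraph, Finset.mem_image, Finset.mem_univ, true_and, eq_comm]
    have hcard := (congrArg Finset.card this).trans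
      ((Finset.card_image_of_injective _ fun i j h =>
        letterPerm_injective hN (mul_right_cancel h)).trans (Finset.card_fin r))
    rw [SimpleGraph.card_neighborFinset_eq_degree] at hcard
    convert hcard
  · exact le_trans (by exact_mod_cast g.le_succ) (letterGraph_egirth hN)

/-! ### The expected size of the greedy independent set -/

/-- The nodes that remain after `v` is selected. -/
noncomputable def removeNbhd {V : Type*} (G : SimpleGraph V) (R : Finset V) (v : V) : Finset V :=
  open Classical in R.filter fun w => w ≠ v ∧ ¬ G.Adj v w

theorem mem_removeNbhd {V : Type*} {G : SimpleGraph V} {R : Finset V} {v w : V} :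
    w ∈ removeNbhd G R v ↔ w ∈ R ∧ w ≠ v ∧ ¬ G.Adj v w := by
  simp [removeNbhd]

theorem removeNbhd_subset {V : Type*} (G : SimpleGraph V) (R : Finset V) (v : V) :
    removeNbhd G R v ⊆ R := fun _ h => (mem_removeNbhd.1 h).1

theorem removeNbhd_ssubset {V : Type*} {G : SimpleGraph V} {R : Finset V} {v : V} (hv : v ∈ R) :
    removeNbhd G R v ⊂ R :=
  (Finset.ssubset_iff_of_subset (removeNbhd_subset G R v)).2
    ⟨v, hv, fun h => (mem_removeNbhd.1 h).2.1 rfl⟩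

/-- The expectation of a real function under a law on a finite type. -/
noncomputable def pmfExpect {α : Type*} [Fintype α] (p : PMF α) (f : α → ℝ) : ℝ :=
  ∑ a, (p a).toReal * f a

theorem pmfExpect_bind {α β : Type*} [Fintype α] [Fintype β] (p : PMF α) (q : α → PMF β)
    (f : β → ℝ) : pmfExpect (p.bind q) f = pmfExpect p fun a => pmfExpect (q a) f := by
  have h (b : β) : (p.bind q b).toReal = ∑ a, (p a).toReal * (q a b).toReal := by
    rw [PMF.bind_apply, tsum_fintype, ENNReal.toReal_sum fun a _ =>
      ENNReal.mul_ne_top (p.apply_ne_top a) ((q a).apply_ne_top b)]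
    simp
  simp only [pmfExpect, h, Finset.sum_mul, Finset.mul_sum]
  rw [Finset.sum_comm]
  simp only [mul_assoc]

theorem pmfExpect_pure {α : Type*} [Fintype α] (a : α) (f : α → ℝ) :
    pmfExpect (PMF.pure a) f = f a := by
  classical
  simp [pmfExpect, PMF.pure_apply, apply_ite ENNReal.toReal]

theorem pmfExpect_map {α β : Type*} [Fintype α] [Fintype β] (p : PMF α) (h : α → β)
    (f : β → ℝ) : pmfExpect (p.map h) f = pmfExpect p (f ∘ h) := by
  simp only [← PMF.bind_pure_comp, pmfExpect_bind, Function.comp_def, pmfExpect_pure]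

theorem sum_toReal_pmf {α : Type*} [Fintype α] (p : PMF α) : ∑ a, (p a).toReal = 1 := by
  rw [← ENNReal.toReal_sum fun a _ => p.apply_ne_top a, ← tsum_fintype (L := .unconditional α),
    p.tsum_coe, ENNReal.toReal_one]

theorem greedyFrom_empty {V : Type*} (G : SimpleGraph V) : greedyFrom G ∅ = PMF.pure ∅ := by
  rw [greedyFrom]; simp

open Classical in
theorem greedyFrom_nonempty {V : Type*} (G : SimpleGraph V) {R : Finset V} (h : R.Nonempty) :
    have : Nonempty R := h.to_subtype
    greedyFrom G R = (PMF.uniformOfFintype R).bind fun v =>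
      (greedyFrom G (removeNbhd G R v)).map fun I => insert v.1 I := by
  rw [greedyFrom, dif_pos h]
  rfl

theorem subset_of_greedyFrom_ne_zero {V : Type*} (G : SimpleGraph V) (R I : Finset V)
    (hI : greedyFrom G R I ≠ 0) : I ⊆ R := by
  classical
  induction R using Finset.strongInduction generalizing I with
  | H R ih =>
    rcases R.eq_empty_or_nonempty with rfl | h
    · rw [greedyFrom_empty] at hI
      have : I = ∅ := by simpa [PMF.pure_apply] using hI
      simp [this]
    · have : Nonempty R := h.to_subtype
      rw [greedyFrom_nonempty G h, ← PMF.mem_support_iff, PMF.mem_support_bind_iff] at hI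
      obtain ⟨v, -, hI⟩ := hI
      rw [PMF.mem_support_map_iff] at hI
      obtain ⟨J, hJ, rfl⟩ := hI
      have hJ := ih _ (removeNbhd_ssubset v.2) J ((PMF.mem_support_iff _ _).1 hJ)
      exact Finset.insert_subset v.2 fun x hx => (removeNbhd_subset G R v) (by convert hJ hx)

/-- The expected size of the greedy independent set among the nodes of `R`. -/
noncomputable def greedySize {V : Type*} [Fintype V] (G : SimpleGraph V) (R : Finset V) : ℝ :=
  pmfExpect (greedyFrom G R) fun I => (I.card : ℝ)

theorem greedySize_nonneg {V : Type*} [Fintype V] (G : SimpleGraph V) (R : Finset V) :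
    0 ≤ greedySize G R :=
  Finset.sum_nonneg fun _ _ => by positivity

theorem greedySize_le {V : Type*} [Fintype V] (G : SimpleGraph V) (R : Finset V) :
    greedySize G R ≤ R.card := by
  calc greedySize G R ≤ ∑ I, (greedyFrom G R I).toReal * (R.card : ℝ) := by
        refine Finset.sum_le_sum fun I _ => ?_
        by_cases hI : greedyFrom G R I = 0
        · simp [hI]
        · exact mul_le_mul_of_nonneg_left (Nat.cast_le.2 <|
            Finset.card_le_card <| subset_of_greedyFrom_ne_zero G R I hI) ENNReal.toReal_nonneg
    _ = R.card := by rw [← Finset.sum_mul, sum_toReal_pmf, one_mul]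

theorem pmfExpect_greedyFrom_insert {V : Type*} [Fintype V] [DecidableEq V] (G : SimpleGraph V)
    (R : Finset V) (v : V) :
    pmfExpect ((greedyFrom G (removeNbhd G R v)).map fun I => insert v I)
      (fun I => (I.card : ℝ)) = greedySize G (removeNbhd G R v) + 1 := by
  rw [pmfExpect_map, greedySize, pmfExpect, pmfExpect,
    ← sum_toReal_pmf (greedyFrom G (removeNbhd G R v)), ← Finset.sum_add_distrib]
  refine Finset.sum_congr rfl fun I _ => ?_
  by_cases hI : greedyFrom G (removeNbhd G R v) I = 0
  · simp [hI]
  · have : v ∉ I := fun h =>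
      (mem_removeNbhd.1 (subset_of_greedyFrom_ne_zero G _ I hI h)).2.1 rfl
    simp [Finset.card_insert_of_notMem this, mul_add]

/-- Conditioning on the first selected node; multiplying by `R.card` also covers the empty set and
matches the rate-one dynamics. -/
theorem card_mul_greedySize {V : Type*} [Fintype V] (G : SimpleGraph V) (R : Finset V) :
    R.card * greedySize G R = ∑ v ∈ R, (greedySize G (removeNbhd G R v) + 1) := by
  classical
  rcases R.eq_empty_or_nonempty with rfl | h
  · simp
  have : Nonempty R := h.to_subtype
  have hR : (R.card : ℝ) ≠ 0 := by simpa using h.ne_empty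
  have h1 : greedySize G R = ∑ v : R, (R.card : ℝ)⁻¹ * (greedySize G (removeNbhd G R v) + 1) := by
    rw [greedySize, greedyFrom_nonempty G h, pmfExpect_bind, pmfExpect]
    refine Finset.sum_congr rfl fun v _ => ?_
    rw [← pmfExpect_greedyFrom_insert]
    simp
  rw [h1, ← Finset.mul_sum, mul_inv_cancel_left₀ hR,
    ← Finset.sum_coe_sort R fun v => greedySize G (removeNbhd G R v) + 1]

theorem expectedGreedyRatio_eq {V : Type*} [Fintype V] (G : SimpleGraph V) :
    expectedGreedyRatio G = greedySize G Finset.univ / Fintype.card V := by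
  simp only [expectedGreedyRatio, greedySize, pmfExpect, Finset.sum_div, mul_div_assoc]
  rfl

/-! ### The greedy algorithm in continuous time -/

/-- The indicator function of the event that all nodes of `S` remain. -/
noncomputable def remainIndicator {V : Type*} (S R : Finset V) : ℝ :=
  open Classical in if S ⊆ R then 1 else 0

theorem remainIndicator_nonneg {V : Type*} (S : Finset V) : 0 ≤ remainIndicator S := fun R => by
  unfold remainIndicator
  split_ifs <;> simp

section Semigroup

variable {V : Type*} [Fintype V] (G : SimpleGraph V)

/-- The generator of the Markov chain in which every remaining node is selected at rate one. -/
noncomputable def greedyGenerator (f : Finset V → ℝ) (R : Finset V) : ℝ :=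
  ∑ v ∈ R, (f (removeNbhd G R v) - f R)

/-- The generator plus the number of nodes times the identity; it preserves nonnegativity. -/
noncomputable def greedyShift : (Finset V → ℝ) →L[ℝ] (Finset V → ℝ) :=
  LinearMap.toContinuousLinearMap
    { toFun := fun f R => greedyGenerator G f R + Fintype.card V * f R
      map_add' := fun f g => by
        ext R
        simp only [greedyGenerator, Pi.add_apply, Finset.sum_sub_distrib, Finset.sum_add_distrib]
        ring
      map_smul' := fun c f => by
        ext R
        simp only [greedyGenerator, Pi.smul_apply, smul_eq_mul, RingHom.id_apply,
          ← mul_sub, ← Finset.mul_sum]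
        ring }

theorem greedyShift_apply (f : Finset V → ℝ) (R : Finset V) :
    greedyShift G f R = greedyGenerator G f R + Fintype.card V * f R := rfl

theorem greedyShift_nonneg {f : Finset V → ℝ} (hf : 0 ≤ f) : 0 ≤ greedyShift G f := fun R => by
  have h1 : (R.card : ℝ) ≤ Fintype.card V := by exact_mod_cast R.card_le_univ
  have h2 : 0 ≤ ∑ v ∈ R, f (removeNbhd G R v) := Finset.sum_nonneg fun v _ => hf _
  have h3 : 0 ≤ (Fintype.card V - R.card : ℝ) * f R := mul_nonneg (sub_nonneg.2 h1) (hf R)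
  simp only [greedyShift_apply, greedyGenerator, Finset.sum_sub_distrib, Finset.sum_const,
    nsmul_eq_mul, Pi.zero_apply]
  linarith

/-- The expectation of `f` at the set of nodes remaining at time `t`. -/
noncomputable def greedyExpect (t : ℝ) (f : Finset V → ℝ) : ℝ :=
  Real.exp (-(Fintype.card V * t)) * NormedSpace.exp (t • greedyShift G) f Finset.univ

theorem greedyExpect_zero (f : Finset V → ℝ) : greedyExpect G 0 f = f Finset.univ := by
  simp [greedyExpect, NormedSpace.exp_zero]

theorem greedyExpect_add (t : ℝ) (f g : Finset V → ℝ) :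
    greedyExpect G t (f + g) = greedyExpect G t f + greedyExpect G t g := by
  simp [greedyExpect, mul_add]

theorem greedyExpect_smul (t c : ℝ) (f : Finset V → ℝ) :
    greedyExpect G t (c • f) = c * greedyExpect G t f := by
  simp [greedyExpect, mul_left_comm]

theorem greedyExpect_sum {ι : Type*} (t : ℝ) (s : Finset ι) (f : ι → Finset V → ℝ) :
    greedyExpect G t (∑ i ∈ s, f i) = ∑ i ∈ s, greedyExpect G t (f i) := by
  simp [greedyExpect, Finset.mul_sum]

/-- Every term of the exponential series of a positivity-preserving operator is nonnegative. This
replaces a construction of the process. -/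
theorem greedyExpect_nonneg {t : ℝ} (ht : 0 ≤ t) {f : Finset V → ℝ} (hf : 0 ≤ f) :
    0 ≤ greedyExpect G t f := by
  have hpow (n : ℕ) : 0 ≤ (greedyShift G ^ n) f := by
    induction n with
    | zero => simpa using hf
    | succ n ih => rw [pow_succ']; exact greedyShift_nonneg G ih
  have h1 := NormedSpace.exp_series_hasSum_exp' (𝕂 := ℝ) (t • greedyShift G)
  have h2 := (h1.mapL (ContinuousLinearMap.apply ℝ (Finset V → ℝ) f)).mapL
    (ContinuousLinearMap.proj (R := ℝ) (φ := fun _ : Finset V => ℝ) Finset.univ)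
  refine mul_nonneg (Real.exp_pos _).le (h2.nonneg fun n => ?_)
  have : 0 ≤ (n.factorial : ℝ)⁻¹ * (t ^ n * (greedyShift G ^ n) f Finset.univ) :=
    mul_nonneg (by positivity) (mul_nonneg (by positivity) (hpow n _))
  simpa [smul_pow] using this

theorem greedyExpect_mono {t : ℝ} (ht : 0 ≤ t) {f g : Finset V → ℝ} (hfg : f ≤ g) :
    greedyExpect G t f ≤ greedyExpect G t g := by
  have h := greedyExpect_nonneg G ht (sub_nonneg.2 hfg)
  have h1 := greedyExpect_add G t f (g - f)
  rw [add_sub_cancel] at h1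
  linarith

theorem hasDerivAt_greedyExpect (f : Finset V → ℝ) (t : ℝ) :
    HasDerivAt (fun t => greedyExpect G t f) (greedyExpect G t (greedyGenerator G f)) t := by
  have h1 : HasDerivAt (fun t : ℝ => NormedSpace.exp (t • greedyShift G) f Finset.univ)
      (NormedSpace.exp (t • greedyShift G) (greedyShift G f) Finset.univ) t :=
    ((ContinuousLinearMap.proj (R := ℝ) (φ := fun _ : Finset V => ℝ)
      Finset.univ).comp (ContinuousLinearMap.apply ℝ (Finset V → ℝ) f)).hasFDerivAt.comp_hasDerivAt
      t (hasDerivAt_exp_smul_const (𝕂 := ℝ) (greedyShift G) t)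
  have h2 : HasDerivAt (fun t : ℝ => Real.exp (-(Fintype.card V * t)))
      (Real.exp (-(Fintype.card V * t)) * -(Fintype.card V * 1)) t :=
    ((hasDerivAt_id t).const_mul _).neg.exp
  refine (h2.mul h1).congr_deriv ?_
  have h3 : greedyShift G f = greedyGenerator G f + (Fintype.card V : ℝ) • f := rfl
  simp only [h3, greedyExpect, map_add, map_smul, Pi.add_apply, Pi.smul_apply, smul_eq_mul]
  ring

theorem greedyGenerator_greedySize :
    greedyGenerator G (greedySize G) = -fun R : Finset V => (R.card : ℝ) := by
  ext R
  have h := card_mul_greedySize G R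
  rw [Finset.sum_add_distrib] at h
  simp only [greedyGenerator, Finset.sum_sub_distrib, Finset.sum_const, nsmul_eq_mul,
    Pi.neg_apply] at h ⊢
  linarith

theorem card_eq_sum_remainIndicator :
    (fun R : Finset V => (R.card : ℝ)) = ∑ v, remainIndicator {v} := by
  classical
  ext R
  simp [remainIndicator, Finset.sum_apply]

/-- The nodes outside `S` that are adjacent to a node of `S`. -/
noncomputable def outerBoundary (S : Finset V) : Finset V :=
  open Classical in Finset.univ.filter fun w => w ∉ S ∧ ∃ v ∈ S, G.Adj v w

variable {G} in
theorem mem_outerBoundary {S : Finset V} {w : V} :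
    w ∈ outerBoundary G S ↔ w ∉ S ∧ ∃ v ∈ S, G.Adj v w := by
  simp [outerBoundary]

/-- Selecting `v` destroys `S` exactly when `v` lies in `S` or in its outer boundary, and a boundary
node can be selected only while it remains. -/
theorem greedyGenerator_remainIndicator [DecidableEq V] (S : Finset V) :
    greedyGenerator G (remainIndicator S) = -((S.card : ℝ) • remainIndicator S +
      ∑ w ∈ outerBoundary G S, remainIndicator (insert w S)) := by
  classical
  ext R
  by_cases hS : S ⊆ R
  · have h1 (v : V) : remainIndicator S (removeNbhd G R v) - remainIndicator S R =
        -((if v ∈ S then 1 else 0) + if v ∈ outerBoundary G S then 1 else 0) := by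
      have hv : S ⊆ removeNbhd G R v ↔ ¬ (v ∈ S ∨ v ∈ outerBoundary G S) := by
        rw [mem_outerBoundary]
        constructor
        · rintro h (hv | ⟨-, w, hw, hwv⟩)
          · exact (mem_removeNbhd.1 (h hv)).2.1 rfl
          · exact (mem_removeNbhd.1 (h hw)).2.2 hwv.symm
        · intro h w hw
          refine mem_removeNbhd.2 ⟨hS hw, ?_, fun hvw => h ?_⟩
          · rintro rfl
            exact h (Or.inl hw)
          · by_cases hvS : v ∈ S
            · exact Or.inl hvS
            · exact Or.inr ⟨hvS, w, hw, hvw.symm⟩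
      have hdisj : v ∈ S → v ∉ outerBoundary G S := fun h h' => (mem_outerBoundary.1 h').1 h
      simp only [remainIndicator, hv, hS, if_true]
      by_cases hvS : v ∈ S
      · simp [hvS, hdisj hvS]
      · by_cases hvB : v ∈ outerBoundary G S <;> simp [hvS, hvB]
    have h2 (w : V) : remainIndicator (insert w S) R = if w ∈ R then 1 else 0 := by
      simp [remainIndicator, Finset.insert_subset_iff, hS]
    have h3 : remainIndicator S R = 1 := if_pos hS
    simp only [greedyGenerator, h1, Finset.sum_neg_distrib, Finset.sum_add_distrib,
      Finset.sum_boole]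
    simp only [Pi.neg_apply, Pi.add_apply, Pi.smul_apply, Finset.sum_apply, h2, h3,
      smul_eq_mul, mul_one, Finset.sum_boole, Finset.filter_mem_eq_inter, Finset.inter_comm R,
      Finset.inter_eq_left.2 hS]
  · have h1 (T : Finset V) (hT : ¬ S ⊆ T) : remainIndicator S T = 0 := if_neg hT
    have h2 (w : V) : remainIndicator (insert w S) R = 0 :=
      if_neg fun h => hS ((Finset.subset_insert w S).trans h)
    have h3 (v : V) : remainIndicator S (removeNbhd G R v) = 0 :=
      h1 _ fun h => hS (h.trans (removeNbhd_subset G R v))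
    simp [greedyGenerator, h1 R hS, h2, h3]

/-- `exp (|S| t)` times the probability that all nodes of `S` remain at time `t`; that is, the
conditional probability given that no node of `S` has been proposed before time `t`. -/
noncomputable def survival (S : Finset V) (t : ℝ) : ℝ :=
  Real.exp (S.card * t) * greedyExpect G t (remainIndicator S)

theorem survival_zero (S : Finset V) : survival G S 0 = 1 := by
  simp [survival, greedyExpect_zero, remainIndicator]

theorem survival_nonneg (S : Finset V) {t : ℝ} (ht : 0 ≤ t) : 0 ≤ survival G S t :=
  mul_nonneg (Real.exp_pos _).le (greedyExpect_nonneg G ht (remainIndicator_nonneg S))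

/-- The exponential weight absorbs the loss from selections inside `S`; the factor `exp (-t)`
corrects for the weight of the one extra node. -/
theorem hasDerivAt_survival [DecidableEq V] (S : Finset V) (t : ℝ) :
    HasDerivAt (survival G S)
      (-(Real.exp (-t) * ∑ w ∈ outerBoundary G S, survival G (insert w S) t)) t := by
  have h1 : HasDerivAt (fun t : ℝ => Real.exp (S.card * t))
      (Real.exp (S.card * t) * (S.card * 1)) t := ((hasDerivAt_id t).const_mul _).exp
  refine (h1.mul (hasDerivAt_greedyExpect G (remainIndicator S) t)).congr_deriv ?_
  have h2 : ∀ w ∈ outerBoundary G S, survival G (insert w S) t =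
      Real.exp t * (Real.exp (S.card * t) * greedyExpect G t (remainIndicator (insert w S))) := by
    intro w hw
    rw [survival, Finset.card_insert_of_notMem (mem_outerBoundary.1 hw).1, ← mul_assoc,
      ← Real.exp_add]
    push_cast
    ring_nf
  have h3 (x : ℝ) : Real.exp (-t) * (Real.exp t * x) = x := by
    rw [← mul_assoc, ← Real.exp_add, neg_add_cancel, Real.exp_zero, one_mul]
  rw [greedyGenerator_remainIndicator, Finset.sum_congr rfl h2, ← Finset.mul_sum, h3,
    ← neg_one_smul ℝ, greedyExpect_smul, greedyExpect_add, greedyExpect_smul, greedyExpect_sum,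
    ← Finset.mul_sum]
  ring

theorem survival_le_one (S : Finset V) {t : ℝ} (ht : 0 ≤ t) : survival G S t ≤ 1 := by
  classical
  have h : AntitoneOn (survival G S) (Set.Ici 0) := by
    refine antitoneOn_of_deriv_nonpos (convex_Ici 0)
      (fun t _ => (hasDerivAt_survival G S t).continuousAt.continuousWithinAt)
      (fun t _ => (hasDerivAt_survival G S t).differentiableAt.differentiableWithinAt) ?_
    intro t ht
    rw [interior_Ici, Set.mem_Ioi] at ht
    rw [(hasDerivAt_survival G S t).deriv, neg_nonpos]
    exact mul_nonneg (Real.exp_pos _).le (Finset.sum_nonneg fun w _ => survival_nonneg G _ ht.le)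
  simpa [survival_zero] using h Set.self_mem_Ici ht ht

end Semigroup

/-! ### Connected sets of nodes in graphs of large girth -/

section Connected

variable {V : Type*} {G : SimpleGraph V}

/-- The finite sets of nodes that arise from a single node by repeatedly adding adjacent nodes. -/
inductive IsClusterOf (G : SimpleGraph V) : Finset V → Prop
  | singleton (v : V) : IsClusterOf G {v}
  | cons (S : Finset V) (v w : V) (hS : IsClusterOf G S) (hv : v ∈ S) (hw : w ∉ S)
      (hvw : G.Adj v w) : IsClusterOf G (S.cons w hw)

theorem IsClusterOf.insert [Fintype V] [DecidableEq V] {S : Finset V} (hS : IsClusterOf G S)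
    {w : V} (hw : w ∈ outerBoundary G S) : IsClusterOf G (insert w S) := by
  obtain ⟨hwS, v, hv, hvw⟩ := mem_outerBoundary.1 hw
  rw [← Finset.cons_eq_insert w S hwS]
  exact .cons S v w hS hv hwS hvw

theorem IsClusterOf.exists_walk {S : Finset V} (hS : IsClusterOf G S) {a b : V} (ha : a ∈ S)
    (hb : b ∈ S) : ∃ p : G.Walk a b, ∀ x ∈ p.support, x ∈ S := by
  induction hS generalizing a b with
  | singleton v =>
    rw [Finset.mem_singleton] at ha hb
    subst ha hb
    exact ⟨.nil, by simp⟩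
  | cons S v w hS hv hw hvw ih =>
    rw [Finset.mem_cons] at ha hb
    have key {a b : V} (p : G.Walk a b) (hp : ∀ x ∈ p.support, x ∈ S) :
        ∀ x ∈ p.support, x ∈ S.cons w hw := fun x hx => Finset.mem_cons_of_mem (hp x hx)
    rcases ha with rfl | ha <;> rcases hb with rfl | hb
    · exact ⟨.nil, by simp⟩
    · obtain ⟨p, hp⟩ := ih hv hb
      refine ⟨.cons hvw.symm p, fun x hx => ?_⟩
      rw [SimpleGraph.Walk.support_cons, List.mem_cons] at hx
      exact hx.elim (fun h => by simp [h]) (key p hp x)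
    · obtain ⟨p, hp⟩ := ih ha hv
      refine ⟨p.concat hvw, fun x hx => ?_⟩
      rw [SimpleGraph.Walk.support_concat, List.mem_append] at hx
      exact hx.elim (key p hp x) (fun h => by simp_all)
    · obtain ⟨p, hp⟩ := ih ha hb
      exact ⟨p, key p hp⟩

/-- In a graph of large girth, a node outside a cluster has at most one neighbour in it. -/
theorem IsClusterOf.eq_of_adj {S : Finset V} (hS : IsClusterOf G S)
    (hg : ((S.card + 2 : ℕ) : ℕ∞) ≤ G.egirth) {a b w : V} (ha : a ∈ S) (hb : b ∈ S) (hw : w ∉ S)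
    (haw : G.Adj a w) (hbw : G.Adj b w) : a = b := by
  classical
  by_contra hab
  obtain ⟨q, hq⟩ := hS.exists_walk ha hb
  have hp : q.bypass.IsPath := q.bypass_isPath
  have hpS : ∀ x ∈ q.bypass.support, x ∈ S := fun x hx => hq x (q.support_bypass_subset_support hx)
  generalize q.bypass = p at hp hpS
  have hlen : p.length + 1 ≤ S.card := by
    rw [← p.length_support, ← List.toFinset_card_of_nodup hp.support_nodup]
    exact Finset.card_le_card fun x hx => hpS x (List.mem_toFinset.1 hx)
  have hwp : w ∉ p.support := fun h => hw (hpS w h)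
  -- The path inside `S` has at most `|S| - 1` edges, so closing it through `w` gives a cycle of
  -- length at most `|S| + 1`.
  have hcyc : (SimpleGraph.Walk.cons hbw.symm.symm (.cons haw.symm p)).IsCycle := by
    rw [SimpleGraph.Walk.cons_isCycle_iff]
    refine ⟨hp.cons hwp, fun h => ?_⟩
    rw [SimpleGraph.Walk.edges_cons, List.mem_cons] at h
    rcases h with h | h
    · rw [Sym2.eq_swap, Sym2.congr_right] at h
      exact hab h.symm
    · exact hwp (p.snd_mem_support_of_mem_edges h)
  have h1 := hg.trans (SimpleGraph.le_egirth.1 le_rfl _ _ hcyc)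
  rw [Nat.cast_le] at h1
  simp only [SimpleGraph.Walk.length_cons] at h1
  omega

-- The cluster induces a tree, with `|S| - 1` edges each counted twice: every added node has exactly
-- one neighbour among the earlier ones.
open Classical in
theorem IsClusterOf.sum_card_filter_adj {S : Finset V} (hS : IsClusterOf G S)
    (hg : ((S.card + 1 : ℕ) : ℕ∞) ≤ G.egirth) :
    (∑ v ∈ S, (S.filter (G.Adj v)).card) + 2 = 2 * S.card := by
  induction hS with
  | singleton v => simp [Finset.filter_singleton]
  | cons S v w hS hv hw hvw ih =>
    rw [Finset.card_cons] at hg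
    have ih := ih (le_trans (by exact_mod_cast Nat.le_succ _) hg)
    have huniq (u : V) (hu : u ∈ S) : G.Adj u w ↔ u = v :=
      ⟨fun h => hS.eq_of_adj hg hu hv hw h hvw, fun h => h ▸ hvw⟩
    have h1 : ((S.cons w hw).filter (G.Adj w)).card = 1 := by
      rw [Finset.filter_cons_of_neg _ _ _ _ (G.irrefl), Finset.card_eq_one]
      refine ⟨v, Finset.ext fun u => ?_⟩
      rw [Finset.mem_filter, Finset.mem_singleton, G.adj_comm]
      exact ⟨fun h => (huniq u h.1).1 h.2, fun h => h ▸ ⟨hv, hvw⟩⟩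
    have h2 : ∀ u ∈ S, ((S.cons w hw).filter (G.Adj u)).card =
        (S.filter (G.Adj u)).card + if u = v then 1 else 0 := by
      intro u hu
      rw [Finset.filter_cons]
      by_cases h : u = v
      · rw [if_pos ((huniq u hu).2 h), Finset.card_cons, if_pos h]
      · rw [if_neg fun h' => h ((huniq u hu).1 h'), if_neg h, add_zero]
    rw [Finset.sum_cons, h1, Finset.sum_congr rfl h2, Finset.sum_add_distrib,
      Finset.sum_ite_eq' S v, if_pos hv, Finset.card_cons]
    omega

-- Of the `(d + 2) |S|` edge ends at `S`, the induced tree uses `2 |S| - 2`; the others reach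
-- distinct boundary nodes.
open Classical in
theorem IsClusterOf.card_outerBoundary [Fintype V] {S : Finset V} (hS : IsClusterOf G S) {d : ℕ}
    (hd : ∀ v, (Finset.univ.filter (G.Adj v)).card = d + 2)
    (hg : ((S.card + 2 : ℕ) : ℕ∞) ≤ G.egirth) :
    (outerBoundary G S).card = d * S.card + 2 := by
  have h1 : ∑ v ∈ S, ((outerBoundary G S).filter (G.Adj v)).card = (outerBoundary G S).card := by
    have := Finset.sum_card_bipartiteAbove_eq_sum_card_bipartiteBelow (s := S)
      (t := outerBoundary G S) G.Adj
    simp only [Finset.bipartiteAbove, Finset.bipartiteBelow] at this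
    rw [this, Finset.card_eq_sum_ones]
    refine Finset.sum_congr rfl fun w hw => ?_
    obtain ⟨hwS, v, hv, hvw⟩ := mem_outerBoundary.1 hw
    refine Finset.card_eq_one.2 ⟨v, Finset.ext fun u => ?_⟩
    rw [Finset.mem_filter, Finset.mem_singleton]
    exact ⟨fun h => hS.eq_of_adj hg h.1 hv hwS h.2 hvw, fun h => h ▸ ⟨hv, hvw⟩⟩
  have h2 : ∀ v ∈ S, (S.filter (G.Adj v)).card + ((outerBoundary G S).filter (G.Adj v)).card =
      d + 2 := by
    intro v hv
    rw [← hd v, ← Finset.card_union_of_disjoint]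
    · congr 1
      ext w
      simp only [Finset.mem_union, Finset.mem_filter, mem_outerBoundary, Finset.mem_univ, true_and]
      constructor
      · rintro (h | h)
        exacts [h.2, h.2]
      · intro h
        by_cases hw : w ∈ S
        · exact Or.inl ⟨hw, h⟩
        · exact Or.inr ⟨⟨hw, v, hv, h⟩, h⟩
    · exact Finset.disjoint_left.2 fun w hw hw' =>
        (mem_outerBoundary.1 (Finset.mem_filter.1 hw').1).1 (Finset.mem_filter.1 hw).1
  have h3 := hS.sum_card_filter_adj (le_trans (by exact_mod_cast Nat.le_succ _) hg)
  have h4 := Finset.sum_congr rfl h2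
  rw [Finset.sum_add_distrib, h1, Finset.sum_const, smul_eq_mul] at h4
  linarith

end Connected

/-! ### Convergence of the survival probabilities -/

/-- The limiting probability that a neighbour `w` of a node `v` has not been selected by time `t`,
given that `v` has not been proposed by then, in graphs of degree `d + 2` and growing girth. -/
noncomputable def treeSurvival (d : ℕ) (t : ℝ) : ℝ :=
  (1 + d * (1 - Real.exp (-t))) ^ (-(1 / (d : ℝ)))

theorem treeSurvival_base_pos (d : ℕ) {t : ℝ} (ht : 0 ≤ t) :
    0 < 1 + d * (1 - Real.exp (-t)) := by
  have : Real.exp (-t) ≤ 1 := Real.exp_le_one_iff.2 (by linarith)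
  have := mul_nonneg (Nat.cast_nonneg (α := ℝ) d) (sub_nonneg.2 this)
  linarith

theorem treeSurvival_zero (d : ℕ) : treeSurvival d 0 = 1 := by simp [treeSurvival]

theorem treeSurvival_nonneg (d : ℕ) {t : ℝ} (ht : 0 ≤ t) : 0 ≤ treeSurvival d t :=
  Real.rpow_nonneg (treeSurvival_base_pos d ht).le _

theorem treeSurvival_le_one (d : ℕ) {t : ℝ} (ht : 0 ≤ t) : treeSurvival d t ≤ 1 := by
  refine Real.rpow_le_one_of_one_le_of_nonpos ?_ (by simp)
  have : Real.exp (-t) ≤ 1 := Real.exp_le_one_iff.2 (by linarith)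
  have := mul_nonneg (Nat.cast_nonneg (α := ℝ) d) (sub_nonneg.2 this)
  linarith

theorem hasDerivAt_treeSurvival {d : ℕ} (hd : d ≠ 0) {t : ℝ} (ht : 0 ≤ t) :
    HasDerivAt (treeSurvival d) (-(Real.exp (-t) * treeSurvival d t ^ (d + 1))) t := by
  have hb := treeSurvival_base_pos d ht
  have hd' : (d : ℝ) ≠ 0 := Nat.cast_ne_zero.2 hd
  have h1 : HasDerivAt (fun t : ℝ => 1 + d * (1 - Real.exp (-t)))
      (d * -(Real.exp (-t) * -1)) t :=
    (((hasDerivAt_id t).neg.exp.const_sub 1).const_mul (d : ℝ)).const_add 1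
  refine (h1.rpow_const (p := -(1 / (d : ℝ))) (Or.inl hb.ne')).congr_deriv ?_
  have h2 : treeSurvival d t ^ (d + 1) =
      (1 + d * (1 - Real.exp (-t))) ^ (-(1 / (d : ℝ)) - 1) := by
    rw [treeSurvival, ← Real.rpow_natCast, ← Real.rpow_mul hb.le]
    congr 1
    push_cast
    field_simp
    ring
  rw [h2]
  field_simp

theorem hasDerivAt_treeSurvival_pow {d : ℕ} (hd : d ≠ 0) (k : ℕ) {t : ℝ} (ht : 0 ≤ t) :
    HasDerivAt (fun t => treeSurvival d t ^ (d * k + 2))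
      (-(Real.exp (-t) * ((d * k + 2 : ℕ) * treeSurvival d t ^ (d * (k + 1) + 2)))) t := by
  refine ((hasDerivAt_treeSurvival hd ht).pow (d * k + 2)).congr_deriv ?_
  rw [show d * (k + 1) + 2 = (d * k + 2 - 1) + (d + 1) by rw [mul_add]; omega, pow_add]
  ring

theorem IsClusterOf.card_pos {V : Type*} {G : SimpleGraph V} {S : Finset V}
    (hS : IsClusterOf G S) : 1 ≤ S.card := by
  cases hS with
  | singleton v => simp
  | cons S v w => simp

section Step

variable {V : Type*} [Fintype V] {G : SimpleGraph V}

theorem abs_survival_sub_le_one (d : ℕ) (S : Finset V) {t : ℝ} (ht : 0 ≤ t) :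
    |survival G S t - treeSurvival d t ^ (d * S.card + 2)| ≤ 1 := by
  have h1 := survival_nonneg G S ht
  have h2 := survival_le_one G S ht
  have h3 : 0 ≤ treeSurvival d t ^ (d * S.card + 2) := pow_nonneg (treeSurvival_nonneg d ht) _
  have h4 : treeSurvival d t ^ (d * S.card + 2) ≤ 1 :=
    pow_le_one₀ (treeSurvival_nonneg d ht) (treeSurvival_le_one d ht)
  rw [abs_le]
  constructor <;> linarith

/-- These powers solve exactly the majorant hierarchy `B_k' = k c B_(k+1)` that controls the errors.
-/
theorem hasDerivAt_inv_pow {c a t : ℝ} (k : ℕ) (h : 1 / 2 - c * (t - a) ≠ 0) :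
    HasDerivAt (fun t => (1 / 2 - c * (t - a))⁻¹ ^ k)
      (k * c * (1 / 2 - c * (t - a))⁻¹ ^ (k + 1)) t := by
  have h1 : HasDerivAt (fun t : ℝ => 1 / 2 - c * (t - a)) (-(c * 1)) t :=
    (((hasDerivAt_id t).sub_const a).const_mul c).const_sub (1 / 2)
  refine ((h1.inv h).pow k).congr_deriv ?_
  rcases k with _ | k
  · simp
  · simp only [Nat.add_sub_cancel, pow_succ, Pi.inv_apply]
    field_simp

open Classical in
/-- If the survival probabilities of clusters of at most `K` nodes are close to their limits at
time `a`, then they stay close for some time that does not depend on `K`. -/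
theorem abs_survival_sub_le {d : ℕ} (hd : d ≠ 0)
    (hreg : ∀ v, (Finset.univ.filter (G.Adj v)).card = d + 2) {K : ℕ}
    (hg : ((K + 2 : ℕ) : ℕ∞) ≤ G.egirth) {a η : ℝ} (ha : 0 ≤ a) (hη : 0 ≤ η)
    (hK : 1 ≤ η * 2 ^ K)
    (h0 : ∀ S, IsClusterOf G S → S.card ≤ K →
      |survival G S a - treeSurvival d a ^ (d * S.card + 2)| ≤ η)
    {S : Finset V} (hS : IsClusterOf G S) (hSK : S.card ≤ K) {t : ℝ} (hat : a ≤ t)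
    (hta : t ≤ a + 1 / (4 * (d + 2))) :
    |survival G S t - treeSurvival d t ^ (d * S.card + 2)| ≤
      η * (1 / 2 - (d + 2) * (t - a))⁻¹ ^ S.card := by
  have hd0 : (0 : ℝ) ≤ d := Nat.cast_nonneg d
  have hc {x : ℝ} (hx : x ≤ a + 1 / (4 * (d + 2))) : 1 / 4 ≤ 1 / 2 - (d + 2) * (x - a) := by
    have h1 : ((d : ℝ) + 2) * (x - a) ≤ (d + 2) * (1 / (4 * (d + 2))) :=
      mul_le_mul_of_nonneg_left (by linarith) (by linarith)
    have h2 : ((d : ℝ) + 2) * (1 / (4 * (d + 2))) = 1 / 4 := by field_simp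
    linarith
  have hc2 {x : ℝ} (hx : a ≤ x) (hx' : x ≤ a + 1 / (4 * (d + 2))) :
      2 ≤ (1 / 2 - (d + 2) * (x - a))⁻¹ := by
    rw [le_inv_comm₀ two_pos (by linarith [hc hx'])]
    have : 0 ≤ ((d : ℝ) + 2) * (x - a) := mul_nonneg (by linarith) (by linarith)
    linarith
  -- Downward induction on cluster size from `K`: the bound for size `k + 1` controls the derivative
  -- of the error at size `k`. At size `K` the trivial bound 1 suffices, since the comparison base
  -- is at least 2 and `1 ≤ η * 2 ^ K`.
  obtain ⟨n, hn⟩ := Nat.exists_eq_add_of_le hSK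
  induction n generalizing S t with
  | zero =>
    calc _ ≤ 1 := abs_survival_sub_le_one d S (ha.trans hat)
      _ ≤ η * 2 ^ K := hK
      _ = η * 2 ^ S.card := by rw [hn, add_zero]
      _ ≤ _ := by
        have := hc2 hat hta
        gcongr
  | succ n ih =>
    have hg' : ((S.card + 2 : ℕ) : ℕ∞) ≤ G.egirth :=
      le_trans (by exact_mod_cast Nat.add_le_add_right hSK 2) hg
    have hcard := hS.card_outerBoundary hreg hg'
    have hderiv (x : ℝ) (hx : 0 ≤ x) := (hasDerivAt_survival G S x).sub
      (hasDerivAt_treeSurvival_pow hd S.card hx)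
    have hB (x : ℝ) (hx : x ≤ a + 1 / (4 * (d + 2))) :=
      (hasDerivAt_inv_pow (c := (d : ℝ) + 2) (a := a) S.card
        (lt_of_lt_of_le (by norm_num) (hc hx)).ne').const_mul η
    refine image_norm_le_of_norm_deriv_right_le_deriv_boundary'
      (f := fun x => survival G S x - treeSurvival d x ^ (d * S.card + 2))
      (B := fun x => η * (1 / 2 - (d + 2) * (x - a))⁻¹ ^ S.card)
      (fun x hx => (hderiv x (ha.trans hx.1)).continuousAt.continuousWithinAt)
      (fun x hx => (hderiv x (ha.trans hx.1)).hasDerivWithinAt) ?_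
      (fun x hx => (hB x hx.2).continuousAt.continuousWithinAt)
      (fun x hx => (hB x hx.2.le).hasDerivWithinAt) ?_ ⟨hat, hta⟩
    · refine (h0 S hS hSK).trans ?_
      have : (1 : ℝ) ≤ (1 / 2 - (d + 2) * (a - a))⁻¹ ^ S.card := one_le_pow₀ (by norm_num)
      exact le_mul_of_one_le_right hη this
    · intro x hx
      have hx0 : 0 ≤ x := ha.trans hx.1
      set b : ℝ := (1 / 2 - (d + 2) * (x - a))⁻¹ with hb
      have hb2 : 2 ≤ b := hc2 hx.1 hx.2.le
      have hsum : |∑ w ∈ outerBoundary G S, (survival G (insert w S) x -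
          treeSurvival d x ^ (d * (S.card + 1) + 2))| ≤
          (outerBoundary G S).card * (η * b ^ (S.card + 1)) := by
        rw [← nsmul_eq_mul]
        refine (Finset.abs_sum_le_sum_abs _ _).trans (Finset.sum_le_card_nsmul _ _ _ fun w hw => ?_)
        have hw' := Finset.card_insert_of_notMem (mem_outerBoundary.1 hw).1
        have := ih (hS.insert hw) (by omega) hx.1 hx.2.le (by omega)
        rwa [hw'] at this
      have hk : (1 : ℝ) ≤ S.card := by exact_mod_cast hS.card_pos
      have hexp : Real.exp (-x) ≤ 1 := Real.exp_le_one_iff.2 (by linarith)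
      rw [show ∀ u v w : ℝ, -(u * v) - -(u * w) = -(u * (v - w)) from fun u v w => by ring,
        norm_neg, norm_mul, Real.norm_of_nonneg (Real.exp_pos _).le, Real.norm_eq_abs]
      rw [Finset.sum_sub_distrib, Finset.sum_const, nsmul_eq_mul, hcard] at hsum
      refine (mul_le_of_le_one_left (abs_nonneg _) hexp).trans (hsum.trans ?_)
      have h1 : 0 ≤ η * b ^ (S.card + 1) := by positivity
      -- A cluster is nonempty; this is why the comparison function has rate `d + 2`.
      have h2 : ((d * S.card + 2 : ℕ) : ℝ) ≤ S.card * (d + 2) := by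
        push_cast
        linarith
      calc _ ≤ S.card * (d + 2) * (η * b ^ (S.card + 1)) := mul_le_mul_of_nonneg_right h2 h1
        _ = _ := by ring

end Step

-- Induction on the number `j` of windows. One window multiplies the error by at most `4 ^ k`, at
-- the price of controlling larger clusters at its start.
open Classical in
theorem exists_girth_abs_survival_sub_le {d : ℕ} (hd : d ≠ 0) (j k : ℕ) {ε : ℝ} (hε : 0 < ε) :
    ∃ g : ℕ, ∀ (V : Type) [Fintype V] (G : SimpleGraph V),
      (∀ v, (Finset.univ.filter (G.Adj v)).card = d + 2) → (g : ℕ∞) ≤ G.egirth →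
      ∀ S, IsClusterOf G S → S.card ≤ k → ∀ t : ℝ, 0 ≤ t → t ≤ j * (1 / (4 * (d + 2))) →
        |survival G S t - treeSurvival d t ^ (d * S.card + 2)| ≤ ε := by
  induction j generalizing k ε with
  | zero =>
    refine ⟨0, fun V _ G _ _ S _ _ t ht0 ht => ?_⟩
    obtain rfl : t = 0 := le_antisymm (by simpa using ht) ht0
    simpa [survival_zero, treeSurvival_zero] using hε.le
  | succ j ih =>
    set η : ℝ := ε / 4 ^ k with hη
    have hη0 : 0 < η := by positivity
    obtain ⟨K, hK⟩ := pow_unbounded_of_one_lt η⁻¹ (one_lt_two : (1 : ℝ) < 2)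
    have hK' : 1 ≤ η * 2 ^ max K k := by
      rw [← inv_le_iff_one_le_mul₀' hη0]
      exact hK.le.trans (pow_le_pow_right₀ one_le_two (le_max_left K k))
    obtain ⟨g, hg⟩ := ih (max K k) hη0
    refine ⟨max g (max K k + 2), fun V _ G hreg hG S hS hSk t ht0 ht => ?_⟩
    have hG1 : (g : ℕ∞) ≤ G.egirth := le_trans (by exact_mod_cast le_max_left _ _) hG
    have hG2 : ((max K k + 2 : ℕ) : ℕ∞) ≤ G.egirth :=
      le_trans (by exact_mod_cast le_max_right _ _) hG
    have hSK := hSk.trans (le_max_right K k)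
    have hd0 : (0 : ℝ) ≤ d := Nat.cast_nonneg d
    rcases le_total t (j * (1 / (4 * (d + 2)))) with h | h
    · exact (hg V G hreg hG1 S hS hSK t ht0 h).trans
        (div_le_self hε.le (one_le_pow₀ (by norm_num)))
    · have hj0 : 0 ≤ (j : ℝ) * (1 / (4 * (d + 2))) := by positivity
      have ht' : t ≤ j * (1 / (4 * (d + 2))) + 1 / (4 * (d + 2)) := by
        push_cast at ht
        linarith
      refine (abs_survival_sub_le hd hreg hG2 hj0 hη0.le hK'
        (fun T hT hTK => hg V G hreg hG1 T hT hTK _ hj0 le_rfl) hS hSK h ht').trans ?_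
      have h1 : (1 / 4 : ℝ) ≤ 1 / 2 - (d + 2) * (t - j * (1 / (4 * (d + 2)))) := by
        have h1 : ((d : ℝ) + 2) * (t - j * (1 / (4 * (d + 2)))) ≤ (d + 2) * (1 / (4 * (d + 2))) :=
          mul_le_mul_of_nonneg_left (by linarith) (by linarith)
        have h2 : ((d : ℝ) + 2) * (1 / (4 * (d + 2))) = 1 / 4 := by field_simp
        linarith
      have h2 : (1 / 2 - (d + 2) * (t - j * (1 / (4 * ((d : ℝ) + 2)))))⁻¹ ≤ 4 :=
        inv_le_of_inv_le₀ (by norm_num) (by linarith)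
      have h3 : (0 : ℝ) ≤ (1 / 2 - (d + 2) * (t - j * (1 / (4 * ((d : ℝ) + 2)))))⁻¹ :=
        inv_nonneg.2 (by linarith)
      calc η * (1 / 2 - (d + 2) * (t - j * (1 / (4 * ((d : ℝ) + 2)))))⁻¹ ^ S.card
          ≤ η * 4 ^ S.card := by gcongr
        _ ≤ η * 4 ^ k := by gcongr; norm_num
        _ = ε := div_mul_cancel₀ ε (by positivity)

/-! ### The limit of the expected greedy ratio -/

/-- The limiting density of nodes selected up to time `t`. -/
noncomputable def treeDensity (d : ℕ) (t : ℝ) : ℝ := (1 - treeSurvival d t ^ 2) / 2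

theorem hasDerivAt_treeDensity {d : ℕ} (hd : d ≠ 0) {t : ℝ} (ht : 0 ≤ t) :
    HasDerivAt (treeDensity d) (Real.exp (-t) * treeSurvival d t ^ (d * 1 + 2)) t := by
  refine ((((hasDerivAt_treeSurvival hd ht).pow 2).const_sub 1).div_const 2).congr_deriv ?_
  ring

theorem tendsto_treeDensity (d : ℕ) :
    Tendsto (treeDensity d) atTop (𝓝 ((1 - ((d : ℝ) + 1) ^ (-2 / (d : ℝ))) / 2)) := by
  have hd0 : (0 : ℝ) ≤ d := Nat.cast_nonneg d
  have h1 : Tendsto (fun t : ℝ => 1 + d * (1 - Real.exp (-t))) atTop (𝓝 (d + 1)) := by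
    have := ((Real.tendsto_exp_neg_atTop_nhds_zero.const_sub 1).const_mul (d : ℝ)).const_add 1
    simpa [add_comm] using this
  have h2 := h1.rpow_const (p := -(1 / (d : ℝ))) (Or.inl (by linarith))
  have h3 : ((d : ℝ) + 1) ^ (-2 / (d : ℝ)) = (((d : ℝ) + 1) ^ (-(1 / (d : ℝ)))) ^ 2 := by
    rw [← Real.rpow_natCast, ← Real.rpow_mul (by linarith)]
    congr 1
    push_cast
    ring
  rw [h3]
  exact ((h2.pow 2).const_sub 1).div_const 2

section Ratio

variable {V : Type*} [Fintype V] (G : SimpleGraph V)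

theorem greedyExpect_card (t : ℝ) :
    greedyExpect G t (fun R => (R.card : ℝ)) = Real.exp (-t) * ∑ v, survival G {v} t := by
  simp only [card_eq_sum_remainIndicator, greedyExpect_sum, survival, Finset.card_singleton,
    Nat.cast_one, one_mul, ← Finset.mul_sum]
  rw [← mul_assoc, ← Real.exp_add, neg_add_cancel, Real.exp_zero, one_mul]

/-- The expected number of selections still to come, per node, plus `treeDensity` is nearly constant
in time. It starts at the greedy ratio, and at time `T` the first summand is at most the expected
fraction of remaining nodes, hence at most `exp (-T)`. -/
theorem abs_greedySize_div_sub_le [Nonempty V] {d : ℕ} (hd : d ≠ 0) {T ε : ℝ} (hT : 0 ≤ T)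
    (h : ∀ v, ∀ t : ℝ, 0 ≤ t → t ≤ T →
      |survival G {v} t - treeSurvival d t ^ (d * 1 + 2)| ≤ ε) :
    |greedySize G Finset.univ / Fintype.card V - treeDensity d T| ≤ ε * T + Real.exp (-T) := by
  have hn : (0 : ℝ) < Fintype.card V := by exact_mod_cast Fintype.card_pos
  have hderiv (t : ℝ) (ht : 0 ≤ t) :=
    ((hasDerivAt_greedyExpect G (greedySize G) t).div_const (Fintype.card V : ℝ)).add
      (hasDerivAt_treeDensity hd ht)
  have hbound := (convex_Icc (0 : ℝ) T).norm_image_sub_le_of_norm_hasDerivWithin_le (C := ε)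
    (fun t ht => (hderiv t ht.1).hasDerivWithinAt) (fun t ht => by
      have h1 : greedyExpect G t (greedyGenerator G (greedySize G)) / Fintype.card V +
          Real.exp (-t) * treeSurvival d t ^ (d * 1 + 2) = -(Real.exp (-t) *
            ((∑ v, (survival G {v} t - treeSurvival d t ^ (d * 1 + 2))) / Fintype.card V)) := by
        rw [greedyGenerator_greedySize, ← neg_one_smul ℝ, greedyExpect_smul, greedyExpect_card,
          Finset.sum_sub_distrib, Finset.sum_const, Finset.card_univ, nsmul_eq_mul]
        field_simp
        ring
      have h2 : |∑ v, (survival G {v} t - treeSurvival d t ^ (d * 1 + 2))| ≤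
          Fintype.card V * ε := by
        rw [← nsmul_eq_mul, ← Finset.card_univ]
        exact (Finset.abs_sum_le_sum_abs _ _).trans
          (Finset.sum_le_card_nsmul _ _ _ fun v _ => h v t ht.1 ht.2)
      rw [h1, norm_neg, norm_mul, Real.norm_of_nonneg (Real.exp_pos _).le, norm_div,
        Real.norm_of_nonneg hn.le, Real.norm_eq_abs]
      refine (mul_le_of_le_one_left (by positivity)
        (Real.exp_le_one_iff.2 (by linarith [ht.1]))).trans ?_
      rwa [div_le_iff₀' hn])
    (Set.left_mem_Icc.2 hT) (Set.right_mem_Icc.2 hT)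
  have h0 : 0 ≤ greedyExpect G T (greedySize G) / Fintype.card V :=
    div_nonneg (greedyExpect_nonneg G hT (greedySize_nonneg G)) hn.le
  have h1 : greedyExpect G T (greedySize G) / Fintype.card V ≤ Real.exp (-T) := by
    rw [div_le_iff₀ hn]
    refine (greedyExpect_mono G hT (greedySize_le G)).trans ?_
    rw [greedyExpect_card]
    refine mul_le_mul_of_nonneg_left ?_ (Real.exp_pos _).le
    calc ∑ v, survival G {v} T ≤ ∑ _v : V, (1 : ℝ) :=
          Finset.sum_le_sum fun v _ => survival_le_one G {v} hT
      _ = Fintype.card V := by simp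
  have hz : treeDensity d 0 = 0 := by simp [treeDensity, treeSurvival_zero]
  simp only [Pi.add_apply, greedyExpect_zero, hz, add_zero, sub_zero, Real.norm_eq_abs,
    abs_of_nonneg hT] at hbound
  rw [abs_le] at hbound ⊢
  constructor <;> linarith [hbound.1, hbound.2]

end Ratio

theorem exists_girth_abs_ratio_sub_le {d : ℕ} (hd : d ≠ 0) {ε : ℝ} (hε : 0 < ε) :
    ∃ g₀ : ℕ, ∀ g, g₀ ≤ g → ∀ H : RegularGirthGraph g (d + 2),
      |H.ratio - (1 - ((d : ℝ) + 1) ^ (-2 / (d : ℝ))) / 2| ≤ ε := by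
  classical
  have hd0 : (0 : ℝ) ≤ d := Nat.cast_nonneg d
  have h1 : ∀ᶠ T : ℝ in atTop,
      |treeDensity d T - (1 - ((d : ℝ) + 1) ^ (-2 / (d : ℝ))) / 2| < ε / 3 := by
    have := Metric.tendsto_nhds.1 (tendsto_treeDensity d) (ε / 3) (by positivity)
    simpa only [Real.dist_eq] using this
  have h2 : ∀ᶠ T : ℝ in atTop, Real.exp (-T) < ε / 3 :=
    Real.tendsto_exp_neg_atTop_nhds_zero.eventually_lt_const (by positivity)
  obtain ⟨T, ⟨hT1, hT2⟩, hT⟩ := ((h1.and h2).and (eventually_gt_atTop 0)).exists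
  obtain ⟨j, hj⟩ := exists_nat_ge (T / (1 / (4 * ((d : ℝ) + 2))))
  rw [div_le_iff₀ (by positivity)] at hj
  -- The horizon `T` is fixed before the girth, so the error integrated up to `T` is at most `ε /
  -- 3`; only single nodes matter here.
  obtain ⟨g₀, hg₀⟩ := exists_girth_abs_survival_sub_le hd j 1 (ε := ε / 3 / T) (by positivity)
  refine ⟨g₀, fun g hg H => ?_⟩
  let _ := H.fintypeV
  have _ := H.nonemptyV
  have hreg (v : H.V) : (Finset.univ.filter (H.graph.Adj v)).card = d + 2 := by
    have h := H.regular v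
    rw [← SimpleGraph.card_neighborFinset_eq_degree, SimpleGraph.neighborFinset_eq_filter] at h
    convert h
  have hgirth : (g₀ : ℕ∞) ≤ H.graph.egirth := le_trans (by exact_mod_cast hg) H.girth_ge
  have h3 := abs_greedySize_div_sub_le H.graph hd hT.le (ε := ε / 3 / T) fun v t ht0 ht => by
    simpa using hg₀ H.V H.graph hreg hgirth {v} (.singleton v) (by simp) t ht0 (ht.trans hj)
  rw [div_mul_cancel₀ _ hT.ne', ← expectedGreedyRatio_eq] at h3
  change |expectedGreedyRatio H.graph - _| ≤ ε
  rw [abs_le] at h3 ⊢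
  rw [abs_lt] at hT1
  constructor <;> linarith [h3.1, h3.2, hT1.1, hT1.2]

theorem mainTheorem12 (r : ℕ) (hr : 3 ≤ r) :
    Tendsto (fun g : ℕ => ⨅ H : RegularGirthGraph g r, H.ratio) atTop
      (𝓝 ((1 - ((r : ℝ) - 1) ^ (-2 / ((r : ℝ) - 2))) / 2)) ∧
    Tendsto (fun g : ℕ => ⨆ H : RegularGirthGraph g r, H.ratio) atTop
      (𝓝 ((1 - ((r : ℝ) - 1) ^ (-2 / ((r : ℝ) - 2))) / 2)) := by
  obtain ⟨d, rfl⟩ := Nat.exists_eq_add_of_le' (le_trans (by norm_num) hr : 2 ≤ r)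
  have hd : d ≠ 0 := by omega
  have hr1 : ((d + 2 : ℕ) : ℝ) - 1 = d + 1 := by push_cast; ring
  have hr2 : ((d + 2 : ℕ) : ℝ) - 2 = d := by push_cast; ring
  rw [hr1, hr2]
  constructor <;>
  · refine Metric.tendsto_atTop.2 fun ε hε => ?_
    -- Infimum and supremum preserve only non-strict bounds; halving `ε` recovers the strict
    -- inequality.
    obtain ⟨g₀, hg₀⟩ := exists_girth_abs_ratio_sub_le hd (half_pos hε)
    refine ⟨g₀, fun g hg => ?_⟩
    replace hg₀ := hg₀ g hg
    generalize (1 - ((d : ℝ) + 1) ^ (-2 / (d : ℝ))) / 2 = c at hg₀ ⊢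
    have hlow (H : RegularGirthGraph g (d + 2)) : c - ε / 2 ≤ H.ratio := by
      linarith [(abs_le.1 (hg₀ H)).1]
    have hupp (H : RegularGirthGraph g (d + 2)) : H.ratio ≤ c + ε / 2 := by
      linarith [(abs_le.1 (hg₀ H)).2]
    obtain ⟨H⟩ := RegularGirthGraph.nonempty g (d + 2)
    have hbelow : BddBelow (Set.range fun H : RegularGirthGraph g (d + 2) => H.ratio) :=
      ⟨_, Set.forall_mem_range.2 hlow⟩
    have habove : BddAbove (Set.range fun H : RegularGirthGraph g (d + 2) => H.ratio) :=
      ⟨_, Set.forall_mem_range.2 hupp⟩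
    have h1 := le_ciInf hlow
    have h2 := ciSup_le hupp
    have h3 := ciInf_le hbelow H
    have h4 := le_ciSup habove H
    rw [Real.dist_eq, abs_lt]
    constructor <;> linarith [hlow H, hupp H]
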